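/- Call a Dirichlet series $F(s)=\sum_{n\ge 1}a(n)n^{-s}$ a member of the Selberg class if the following hold. (i) It converges absolutely for $\Re s>1$. (ii) $F$ has a meromorphic continuation to $\mathbb C$ such that $(s-1)^mF(s)$ is entire of finite order for some integer $m\ge 0$. (iii) There are an integer $r\ge 0$, $Q>0$, $\lambda_1,\dots,\lambda_r>0$, $\mu_1,\dots,\mu_r\in\mathbb C$ with $\Re\mu_j\ge 0$, and $\omega\in\mathbb C$ with $|\omega|=1$, such that, identically in $s$, $$Q^s\prod_{j=1}^r\Gamma(\lambda_js+\mu_j)\,F(s)=\omega\, Q^{1-s}\prod_{j=1}^r\Gamma(\lambda_j(1-s)+\overline{\mu_j})\,\overline{F(1-\overline s)}.$$ (iv) $a(n)\ll_\varepsilon n^{\varepsilon}$ for every $\varepsilon>0$. (v) For $\Re s>1$ one has $\log F(s)=\sum_{n\ge1} b(n)n^{-s}$, where $b(n)=0$ unless $n=p^k$ with $p$ prime and $k\ge1$, and $b(n)\ll n^{\theta}$ for some $\theta<1/2$. Let $\sigma_b(F)$, $\sigma_u(F)$, $\sigma_a(F)\in[-\infty,+\infty]$ be the abscissae of boundedness,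 of uniform convergence and of absolute convergence of the series, that is, the infimum of the real $x$ such that, respectively: $F$ has a bounded holomorphic continuation to $\Re s>x$; the series converges uniformly on $\Re s>x$; the series converges absolutely at $s=x$. **Theorem 1.** For every $F$ in the Selberg class, $\sigma_b(F)=\sigma_u(F)=\sigma_a(F)$. -/

import Mathlib

open Complex Filter Asymptotics

/-- The abscissa of uniform convergence of `∑ a(n) n^{-s}`: the infimum (in `[-∞, +∞]`) of the
real `x` such that the partial sums, taken in the natural order, converge uniformly on the
half-plane `Re s > x`. The term `n = 0` of `LSeries.term` is zero. -/
noncomputable def abscissaOfUnifConv (a : ℕ → ℂ) : EReal :=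
  sInf (Real.toEReal '' {x : ℝ | ∃ f : ℂ → ℂ,
    TendstoUniformlyOn (fun (N : ℕ) (s : ℂ) => ∑ n ∈ Finset.range N, LSeries.term a s n)
      f atTop {s : ℂ | x < s.re}})

/-- The abscissa of boundedness of `∑ a(n) n^{-s}`: the infimum (in `[-∞, +∞]`) of the real `x`
such that the sum of the series, defined far to the right, has a bounded holomorphic continuation
to the half-plane `Re s > x`. -/
noncomputable def abscissaOfBoundedness (a : ℕ → ℂ) : EReal :=
  sInf (Real.toEReal '' {x : ℝ | ∃ f : ℂ → ℂ,
    DifferentiableOn ℂ f {s : ℂ | x < s.re} ∧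
    (∃ C : ℝ, ∀ s : ℂ, x < s.re → ‖f s‖ ≤ C) ∧
    (∃ y : ℝ, x ≤ y ∧ ∀ s : ℂ, y < s.re → LSeriesSummable a s ∧ f s = LSeries a s)})

/-- `G` is an entire function of finite order. -/
def IsEntireOfFiniteOrder (G : ℂ → ℂ) : Prop :=
  Differentiable ℂ G ∧ ∃ A C : ℝ, ∀ s : ℂ, ‖G s‖ ≤ C * Real.exp (‖s‖ ^ A)

/-- `F` satisfies the functional equation with data `Q`, `lam`, `mu`, `ω`:
`Q^s ∏ Γ(λ_j s + μ_j) F(s) = ω Q^{1-s} ∏ Γ(λ_j (1-s) + conj μ_j) conj (F(1 - conj s))`,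
as an identity of meromorphic functions on `ℂ`, that is, at every `s` at which neither a Gamma
factor nor `F` (whose only possible pole is at `1`) has a pole on either side. -/
def SatisfiesFunctionalEquation {r : ℕ} (F : ℂ → ℂ) (Q : ℝ) (lam : Fin r → ℝ) (mu : Fin r → ℂ)
    (ω : ℂ) : Prop :=
  ∀ s : ℂ, s ≠ 0 → s ≠ 1 →
    (∀ (j : Fin r) (k : ℕ), (lam j : ℂ) * s + mu j ≠ -(k : ℂ)) →
    (∀ (j : Fin r) (k : ℕ), (lam j : ℂ) * (1 - s) + starRingEnd ℂ (mu j) ≠ -(k : ℂ)) →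
    (Q : ℂ) ^ s * (∏ j, Gamma ((lam j : ℂ) * s + mu j)) * F s =
      ω * (Q : ℂ) ^ (1 - s) * (∏ j, Gamma ((lam j : ℂ) * (1 - s) + starRingEnd ℂ (mu j))) *
        starRingEnd ℂ (F (1 - starRingEnd ℂ s))

/-- The function given by the Dirichlet series `∑_{n ≥ 1} a(n) n^{-s}` belongs to the Selberg
class. (The value `a 0` plays no role.) -/
structure IsSelbergClass (a : ℕ → ℂ) : Prop where
  /-- The Dirichlet series converges absolutely for `Re s > 1`. -/
  summable : ∀ s : ℂ, 1 < s.re → LSeriesSummable a s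
  /-- The sum continues to a function `F` on `ℂ` such that `(s-1)^m F(s)` is entire of finite
  order for some `m ≥ 0` and `F` satisfies a functional equation of Riemann type. (The value
  `F 1` plays no role.) -/
  continuation : ∃ F : ℂ → ℂ,
    (∀ s : ℂ, 1 < s.re → F s = LSeries a s) ∧
    (∃ (m : ℕ) (G : ℂ → ℂ), IsEntireOfFiniteOrder G ∧ ∀ s : ℂ, s ≠ 1 → G s = (s - 1) ^ m * F s) ∧
    (∃ (r : ℕ) (Q : ℝ) (lam : Fin r → ℝ) (mu : Fin r → ℂ) (ω : ℂ),
      0 < Q ∧ (∀ j, 0 < lam j) ∧ (∀ j, 0 ≤ (mu j).re) ∧ ‖ω‖ = 1 ∧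
      SatisfiesFunctionalEquation F Q lam mu ω)
  /-- Ramanujan condition: `a(n) ≪ n^ε` for every `ε > 0`. -/
  ramanujan : ∀ ε : ℝ, 0 < ε → a =O[atTop] fun n : ℕ => (n : ℝ) ^ ε
  /-- Euler product: `log F(s) = ∑ b(n) n^{-s}` for `Re s > 1`, where `b` is supported on the
  prime powers `p^k`, `k ≥ 1`, and `b(n) ≪ n^θ` for some `θ < 1/2`. -/
  euler_product : ∃ b : ℕ → ℂ,
    (∀ n : ℕ, ¬ IsPrimePow n → b n = 0) ∧
    (∃ θ : ℝ, θ < 1 / 2 ∧ b =O[atTop] fun n : ℕ => (n : ℝ) ^ θ) ∧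
    (∀ s : ℂ, 1 < s.re → LSeriesSummable b s ∧ LSeries a s = exp (LSeries b s))

/-!
The inequalities `σ_b ≤ σ_u ≤ σ_a` hold for every Dirichlet series that converges absolutely
somewhere: a uniform limit of bounded holomorphic functions is bounded and holomorphic, and
absolute convergence at a real point `x` gives uniform convergence on `Re s > x`. The content is
`σ_a ≤ σ_b`, which is a consequence of multiplicativity of the coefficients.

Multiplicativity of `a` follows from the Euler product: comparing coefficients in
`F' = F · (log F)'` gives `a(n) log n = ∑_{de = n} a(d) b(e) log e`, and since `b` lives on prime
powers, this recursion splits at coprime factors (`IsSelbergClass.map_mul_of_coprime`).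

Let `f` be the continuation of `F`, bounded by `C` on `Re s > x`, and let `σ > x`. By moving the
line of integration to the right, the mean value of `f(σ + it) (m/d)^{it}` over `t ∈ ℝ`, for
coprime `m`, `d`, is `a(m) m^{-σ}` if `d = 1`, and `0` otherwise (`hasMean_mul_exp_of_bounded`).
For a finite set `P` of primes and a fixed `k ≥ 1`, the Riesz product
`∏_{p ∈ P} (1 + cos (θ_p + k t log p))` is nonnegative with mean `1`, so that the mean of `f`
against it is at most `C` in absolute value. On the other hand, by multiplicativity this mean is
`∏_{p ∈ P} (1 + e^{iθ_p} a(p^k) p^{-kσ} / 2)` (`hasMean_mul_rieszProduct`). With `θ_p` chosen to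
cancel the argument of `a(p^k)`, this yields `∑_{p ∈ P} |a(p^k)| p^{-kσ} ≤ 2C`, uniformly in `P`
and `k` (`sum_norm_term_prime_pow_le`). At `x' > σ` the sums over `k` converge geometrically, so
that `∑_p ∑_{k ≥ 1} |a(p^k)| p^{-kx'}` is finite, and the Euler product of `∑ |a(n)| n^{-x'}` shows
that the series converges absolutely at `x'` (`LSeriesSummable_of_bounded`).
-/

/-! ### Multiplicativity of the coefficients -/

/-- If `a(n) log n = ∑_{de = n} a(d) c(e)` with `c` supported on prime powers, then `a` is
multiplicative: a prime power dividing `m n` with `m`, `n` coprime divides exactly one of them,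
so that the identity at `m n` splits into those at `m` and at `n`, by induction on `m n`. -/
lemma map_mul_of_coprime_of_mul_log_eq {a c : ℕ → ℂ} (ha1 : a 1 = 1)
    (hc : ∀ n, ¬ IsPrimePow n → c n = 0)
    (h : ∀ n ≠ 0, a n * Real.log n = ∑ e ∈ n.divisors, a (n / e) * c e)
    {m n : ℕ} (hm : m ≠ 0) (hn : n ≠ 0) (hmn : m.Coprime n) : a (m * n) = a m * a n := by
  induction hN : m * n using Nat.strong_induction_on generalizing m n with
  | _ N ih =>
  subst hN
  rcases eq_or_ne (m * n) 1 with h1 | h1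
  · obtain ⟨rfl, rfl⟩ := mul_eq_one.mp h1
    simp [ha1]
  have hmn0 : m * n ≠ 0 := mul_ne_zero hm hn
  have hlog : (Real.log (m * n : ℕ) : ℂ) ≠ 0 := by
    have : 0 < Real.log (m * n : ℕ) := Real.log_pos (by exact_mod_cast (by omega : 1 < m * n))
    exact_mod_cast this.ne'
  have key : ∀ e ∈ (m * n).divisors, a (m * n / e) * c e =
      (if e ∣ m then a (m / e) * a n * c e else 0) +
        (if e ∣ n then a m * a (n / e) * c e else 0) := by
    intro e he
    by_cases hpe : IsPrimePow e
    swap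
    · simp [hc e hpe]
    have hdvd := Nat.dvd_of_mem_divisors he
    have he1 : 1 < e := hpe.one_lt
    rcases (Nat.Coprime.isPrimePow_dvd_mul hmn hpe).mp hdvd with ⟨u, rfl⟩ | ⟨u, rfl⟩
    · have hu : u ≠ 0 := right_ne_zero_of_mul hm
      have hne : ¬ e ∣ n := fun hen =>
        he1.ne' (Nat.eq_one_of_dvd_coprimes hmn (dvd_mul_right _ _) hen)
      have hlt : u * n < e * u * n := by
        rw [mul_assoc]; exact lt_mul_left (by positivity) he1
      rw [if_pos (dvd_mul_right _ _), if_neg hne, mul_assoc, Nat.mul_div_cancel_left _ (by omega),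
        Nat.mul_div_cancel_left _ (by omega),
        ih _ hlt hu hn (Nat.Coprime.coprime_dvd_left (dvd_mul_left _ _) hmn) rfl]
      ring
    · have hu : u ≠ 0 := right_ne_zero_of_mul hn
      have hne : ¬ e ∣ m := fun hen =>
        he1.ne' (Nat.eq_one_of_dvd_coprimes hmn hen (dvd_mul_right _ _))
      have hlt : m * u < m * (e * u) := by
        rw [mul_left_comm]; exact lt_mul_left (by positivity) he1
      rw [if_pos (dvd_mul_right _ _), if_neg hne, mul_left_comm,
        Nat.mul_div_cancel_left _ (by omega), Nat.mul_div_cancel_left _ (by omega),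
        ih _ hlt hm hu (Nat.Coprime.coprime_dvd_right (dvd_mul_left _ _) hmn) rfl]
      ring
  have hfilter : ∀ {k : ℕ}, k ∣ m * n → (m * n).divisors.filter (· ∣ k) = k.divisors := by
    intro k hk
    ext e
    simp only [Finset.mem_filter, Nat.mem_divisors]
    exact ⟨fun h => ⟨h.2, ne_zero_of_dvd_ne_zero hmn0 hk⟩, fun h => ⟨⟨h.1.trans hk, hmn0⟩, h.1⟩⟩
  have h2 : a (m * n) * Real.log (m * n : ℕ) = a m * a n * Real.log (m * n : ℕ) := by
    rw [h _ hmn0, Finset.sum_congr rfl key, Finset.sum_add_distrib, ← Finset.sum_filter,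
      ← Finset.sum_filter, hfilter (dvd_mul_right _ _), hfilter (dvd_mul_left _ _)]
    have e1 : ∑ e ∈ m.divisors, a (m / e) * a n * c e = a n * (a m * Real.log m) := by
      rw [h m hm, Finset.mul_sum]
      exact Finset.sum_congr rfl fun _ _ => by ring
    have e2 : ∑ e ∈ n.divisors, a m * a (n / e) * c e = a m * (a n * Real.log n) := by
      rw [h n hn, Finset.mul_sum]
      exact Finset.sum_congr rfl fun _ _ => by ring
    rw [e1, e2, Nat.cast_mul, Real.log_mul (by exact_mod_cast hm) (by exact_mod_cast hn)]
    push_cast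
    ring
  exact mul_right_cancel₀ hlog h2

lemma LSeries.abscissaOfAbsConv_le_one_of_forall_summable {a : ℕ → ℂ}
    (h : ∀ s : ℂ, 1 < s.re → LSeriesSummable a s) : LSeries.abscissaOfAbsConv a ≤ 1 := by
  exact_mod_cast LSeries.abscissaOfAbsConv_le_of_forall_lt_LSeriesSummable (x := 1)
    fun y hy => h y (by simpa using hy)

section ExpLSeries

variable {a b : ℕ → ℂ} (ha : ∀ s : ℂ, 1 < s.re → LSeriesSummable a s)
  (hb : ∀ s : ℂ, 1 < s.re → LSeriesSummable b s)
  (hab : ∀ s : ℂ, 1 < s.re → LSeries a s = exp (LSeries b s))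
include ha hb hab

lemma map_one_eq_exp_of_LSeries_eq_exp : a 1 = exp (b 1) := by
  have hA := (LSeries.abscissaOfAbsConv_le_one_of_forall_summable ha).trans_lt
    (EReal.coe_lt_top 1)
  have hB := (LSeries.abscissaOfAbsConv_le_one_of_forall_summable hb).trans_lt
    (EReal.coe_lt_top 1)
  refine tendsto_nhds_unique (LSeries.tendsto_atTop hA)
    (((continuous_exp.tendsto _).comp (LSeries.tendsto_atTop hB)).congr' ?_)
  filter_upwards [eventually_gt_atTop 1] with x hx
  exact (hab x (by simpa using hx)).symm

/-- Comparison of coefficients in `F' = F · (log F)'`. -/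
lemma mul_log_eq_sum_of_LSeries_eq_exp {n : ℕ} (hn : n ≠ 0) :
    a n * Real.log n = ∑ e ∈ n.divisors, a (n / e) * LSeries.logMul b e := by
  have hA := LSeries.abscissaOfAbsConv_le_one_of_forall_summable ha
  have hB := LSeries.abscissaOfAbsConv_le_one_of_forall_summable hb
  have hB' : LSeries.abscissaOfAbsConv (LSeries.logMul b) ≤ 1 := by
    rwa [LSeries.abscissaOfAbsConv_logMul]
  have hL : (fun x : ℝ => LSeries (LSeries.logMul a) x) =ᶠ[atTop]
      fun x : ℝ => LSeries (LSeries.convolution a (LSeries.logMul b)) x := by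
    filter_upwards [eventually_gt_atTop 1] with x hx
    have hx' : (1 : EReal) < ((x : ℂ).re : EReal) := by
      rw [ofReal_re]; exact_mod_cast hx
    have hev : LSeries a =ᶠ[nhds (x : ℂ)] fun s => exp (LSeries b s) := by
      filter_upwards [(isOpen_lt continuous_const continuous_re).mem_nhds
        (show (1 : ℝ) < (x : ℂ).re by simpa using hx)] with s hs using hab s hs
    have hd := hev.deriv_eq
    rw [LSeries_deriv (hA.trans_lt hx'), (LSeries_hasDerivAt (hB.trans_lt hx')).cexp.deriv,
      ← hab x (by simpa using hx)] at hd
    rw [LSeries_convolution (hA.trans_lt hx') (hB'.trans_lt hx')]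
    linear_combination -hd
  have := LSeries.eq_of_LSeries_eventually_eq
    (by rw [LSeries.abscissaOfAbsConv_logMul]; exact hA.trans_lt (EReal.coe_lt_top 1))
    ((LSeries.abscissaOfAbsConv_convolution_le a _).trans_lt
      ((max_le hA hB').trans_lt (EReal.coe_lt_top 1))) hL hn
  rw [LSeries.convolution_def] at this
  simp only [LSeries.logMul] at this ⊢
  rw [ofReal_log n.cast_nonneg, ofReal_natCast, mul_comm, this,
    Nat.sum_divisorsAntidiagonal' (f := fun x y => a x * (Complex.log y * b y))]

end ExpLSeries

/-- The Euler product determines multiplicative coefficients. -/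
lemma IsSelbergClass.map_mul_of_coprime {a : ℕ → ℂ} (ha : IsSelbergClass a) :
    a 1 = 1 ∧ ∀ {m n : ℕ}, m ≠ 0 → n ≠ 0 → m.Coprime n → a (m * n) = a m * a n := by
  obtain ⟨b, hb, -, hab⟩ := ha.euler_product
  have hB := fun s hs => (hab s hs).1
  have hE := fun s hs => (hab s hs).2
  have h1 : a 1 = 1 := by
    rw [map_one_eq_exp_of_LSeries_eq_exp ha.summable hB hE, hb 1 not_isPrimePow_one, exp_zero]
  exact ⟨h1, map_mul_of_coprime_of_mul_log_eq h1 (fun n hn => by simp [LSeries.logMul, hb n hn])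
    fun n hn => mul_log_eq_sum_of_LSeries_eq_exp ha.summable hB hE hn⟩

/-! ### Comparison of the abscissae in the easy direction -/

lemma abscissaOfUnifConv_le_abscissaOfAbsConv (a : ℕ → ℂ) :
    abscissaOfUnifConv a ≤ LSeries.abscissaOfAbsConv a := by
  refine sInf_le_sInf (Set.image_mono fun x (hx : LSeriesSummable a x) => ⟨LSeries a, ?_⟩)
  exact tendstoUniformlyOn_tsum_nat (Summable.norm hx) fun n s hs =>
    LSeries.norm_term_le_of_re_le_re a (by simpa using (Set.mem_ofPred.mp hs).le) n

lemma LSeries.differentiable_term (a : ℕ → ℂ) (n : ℕ) :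
    Differentiable ℂ fun s => LSeries.term a s n := fun s =>
  (LSeries.hasDerivAt_term a n s).differentiableAt

/-- The hypothesis that the series converges absolutely somewhere serves to identify the uniform
limit with the sum of the series far to the right. -/
lemma abscissaOfBoundedness_le_abscissaOfUnifConv {a : ℕ → ℂ} {y : ℝ}
    (ha : ∀ s : ℂ, y < s.re → LSeriesSummable a s) :
    abscissaOfBoundedness a ≤ abscissaOfUnifConv a := by
  refine sInf_le_sInf (Set.image_mono ?_)
  rintro x ⟨f, hf⟩
  refine ⟨f, ?_, ?_, max x y, le_max_left _ _, fun s hs => ?_⟩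
  · refine hf.tendstoLocallyUniformlyOn.differentiableOn (Eventually.of_forall fun N => ?_)
      (isOpen_lt continuous_const continuous_re)
    exact (Differentiable.fun_sum fun n _ => LSeries.differentiable_term a n).differentiableOn
  · obtain ⟨N, hN⟩ := (Metric.tendstoUniformlyOn_iff.mp hf 1 one_pos).exists
    refine ⟨1 + ∑ n ∈ Finset.range N, ‖LSeries.term a x n‖, fun s hs => ?_⟩
    have h1 := (hN s hs).le
    rw [dist_eq_norm] at h1
    have h2 : ‖∑ n ∈ Finset.range N, LSeries.term a s n‖ ≤
        ∑ n ∈ Finset.range N, ‖LSeries.term a x n‖ :=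
      norm_sum_le_of_le _ fun n _ => LSeries.norm_term_le_of_re_le_re a (by simpa using hs.le) n
    have h3 := norm_sub_norm_le (f s) (∑ n ∈ Finset.range N, LSeries.term a s n)
    linarith
  · have hs' := max_lt_iff.mp hs
    exact ⟨ha s hs'.2, tendsto_nhds_unique (hf.tendsto_at hs'.1)
      (ha s hs'.2).hasSum.tendsto_sum_nat⟩

/-! ### Mean values on vertical lines -/

/-- `g` has the mean value `c` on the real line: `(2T)⁻¹ ∫_{-T}^T g → c` as `T → ∞`. For the
continuous `g` considered here no junk value of the integral is involved. -/
def HasMean (g : ℝ → ℂ) (c : ℂ) : Prop :=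
  Tendsto (fun T : ℝ => ((2 * T : ℝ) : ℂ)⁻¹ * ∫ t in (-T)..T, g t) atTop (nhds c)

lemma HasMean.add {g h : ℝ → ℂ} {c d : ℂ} (hg : HasMean g c) (hh : HasMean h d)
    (hgc : Continuous g) (hhc : Continuous h) : HasMean (fun t => g t + h t) (c + d) := by
  refine (Tendsto.add hg hh).congr fun T => ?_
  rw [intervalIntegral.integral_add (hgc.intervalIntegrable _ _) (hhc.intervalIntegrable _ _),
    mul_add]

lemma HasMean.const_mul {g : ℝ → ℂ} {c : ℂ} (hg : HasMean g c) (z : ℂ) :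
    HasMean (fun t => z * g t) (z * c) := by
  refine (Tendsto.const_mul z hg).congr fun T => ?_
  rw [intervalIntegral.integral_const_mul]
  ring

lemma norm_inv_mul_integral_le {g : ℝ → ℂ} {T C : ℝ} (hT : 0 < T) (hg : ∀ t, ‖g t‖ ≤ C) :
    ‖((2 * T : ℝ) : ℂ)⁻¹ * ∫ t in (-T)..T, g t‖ ≤ C := by
  have h := intervalIntegral.norm_integral_le_of_norm_le_const (a := -T) (b := T)
    (f := g) (C := C) fun t _ => hg t
  rw [sub_neg_eq_add, abs_of_pos (by linarith)] at h
  rw [norm_mul, norm_inv, norm_real, Real.norm_of_nonneg (by linarith),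
    inv_mul_le_iff₀ (by linarith)]
  linarith

lemma HasMean.norm_le {g : ℝ → ℂ} {w : ℝ → ℝ} {c d : ℂ} {C : ℝ} (hg : HasMean g c)
    (hw : HasMean (fun t => (w t : ℂ)) d) (hwc : Continuous w)
    (h : ∀ t, ‖g t‖ ≤ C * w t) : ‖c‖ ≤ C * d.re := by
  refine le_of_tendsto_of_tendsto hg.norm
    (((continuous_re.tendsto d).comp hw).const_mul C) ?_
  filter_upwards [eventually_gt_atTop 0] with T hT
  have h1 : ‖∫ t in (-T)..T, g t‖ ≤ ∫ t in (-T)..T, C * w t :=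
    intervalIntegral.norm_integral_le_of_norm_le (by linarith) (Eventually.of_forall fun t _ => h t)
      ((continuous_const.mul hwc).intervalIntegrable _ _)
  rw [intervalIntegral.integral_const_mul] at h1
  simp only [Function.comp_apply]
  rw [intervalIntegral.integral_ofReal, ← ofReal_inv, ← ofReal_mul, ofReal_re, norm_mul, norm_real,
    Real.norm_of_nonneg (by positivity), mul_left_comm]
  gcongr

lemma hasMean_exp (μ : ℝ) :
    HasMean (fun t => exp (I * (t * μ : ℝ))) (if μ = 0 then 1 else 0) := by
  unfold HasMean
  split_ifs with h
  · refine tendsto_const_nhds.congr' ?_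
    filter_upwards [eventually_gt_atTop 0] with T hT
    have : ((2 * T : ℝ) : ℂ) ≠ 0 := by exact_mod_cast (by linarith : (2 * T) ≠ 0)
    have h2 : ∫ t in (-T)..T, exp (I * (t * μ : ℝ)) = ((2 * T : ℝ) : ℂ) := by
      simp [h, two_mul]
    rw [h2, inv_mul_cancel₀ this]
  · have hc : I * (μ : ℂ) ≠ 0 := mul_ne_zero I_ne_zero (by exact_mod_cast h)
    have hinv : Tendsto (fun T : ℝ => (T : ℝ)⁻¹ * ‖I * (μ : ℂ)‖⁻¹) atTop (nhds 0) := by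
      simpa using tendsto_inv_atTop_zero.mul_const (‖I * (μ : ℂ)‖⁻¹)
    refine squeeze_zero_norm' ?_ hinv
    filter_upwards [eventually_gt_atTop 0] with T hT
    have h2 : ∫ t in (-T)..T, exp (I * (t * μ : ℝ)) =
        (exp (I * μ * T) - exp (I * μ * (-T : ℝ))) / (I * μ) := by
      rw [← integral_exp_mul_complex hc]
      refine intervalIntegral.integral_congr fun t _ => ?_
      congr 1
      push_cast
      ring
    have h3 : ∀ u : ℝ, ‖exp (I * μ * u)‖ = 1 := fun u => by
      rw [mul_assoc, ← ofReal_mul, norm_exp_I_mul_ofReal]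
    have h4 := norm_sub_le (exp (I * μ * T)) (exp (I * μ * (-T : ℝ)))
    rw [h3, h3] at h4
    rw [h2, norm_mul, norm_inv, norm_real, Real.norm_of_nonneg (by positivity), norm_div,
      div_eq_mul_inv, mul_inv, mul_comm (2⁻¹ : ℝ), mul_assoc]
    gcongr
    rw [← mul_assoc]
    refine mul_le_of_le_one_left (by positivity) ?_
    linarith

/-- Bohr's mean value on a vertical line in the half-plane of absolute convergence, termwise. -/
lemma hasMean_LSeries_mul_exp {a : ℕ → ℂ} {σ : ℝ} (ha : LSeriesSummable a σ) (μ : ℝ) :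
    HasMean (fun t => LSeries a (σ + t * I) * exp (I * (t * μ : ℝ)))
      (∑' n : ℕ, if Real.log n = μ then LSeries.term a σ n else 0) := by
  have hterm : ∀ (t : ℝ) (n : ℕ), LSeries.term a (σ + t * I) n * exp (I * (t * μ : ℝ)) =
      LSeries.term a σ n * exp (I * (t * (μ - Real.log n) : ℝ)) := by
    intro t n
    rcases eq_or_ne n 0 with rfl | hn
    · simp
    have hn' : (n : ℂ) ≠ 0 := by exact_mod_cast hn
    rw [LSeries.term_of_ne_zero hn, LSeries.term_of_ne_zero hn, div_eq_mul_inv, ← cpow_neg,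
      div_eq_mul_inv, ← cpow_neg, neg_add, cpow_add _ _ hn', mul_assoc, mul_assoc, mul_assoc]
    congr 2
    rw [cpow_def_of_ne_zero hn', ← exp_add, ← natCast_log]
    congr 1
    push_cast
    ring
  have hnorm : ∀ (t : ℝ) (n : ℕ), ‖LSeries.term a σ n * exp (I * (t * (μ - Real.log n) : ℝ))‖ =
      ‖LSeries.term a σ n‖ := fun t n => by rw [norm_mul, norm_exp_I_mul_ofReal, mul_one]
  have key : Tendsto (fun T : ℝ => ∑' n, ((2 * T : ℝ) : ℂ)⁻¹ * ∫ t in (-T)..T,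
      LSeries.term a σ n * exp (I * (t * (μ - Real.log n) : ℝ))) atTop
      (nhds (∑' n : ℕ, if Real.log n = μ then LSeries.term a σ n else 0)) := by
    refine tendsto_tsum_of_dominated_convergence (Summable.norm ha) (fun n => ?_) ?_
    · have := (hasMean_exp (μ - Real.log n)).const_mul (LSeries.term a σ n)
      simp only [sub_eq_zero, mul_ite, mul_one, mul_zero, eq_comm (a := μ)] at this
      exact this
    · filter_upwards [eventually_gt_atTop 0] with T hT n
      exact norm_inv_mul_integral_le hT fun t => (hnorm t n).le
  refine key.congr fun T => ?_
  rw [tsum_mul_left]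
  congr 1
  have hs := intervalIntegral.hasSum_integral_of_dominated_convergence (a := -T) (b := T)
    (μ := MeasureTheory.volume)
    (F := fun n t => LSeries.term a σ n * exp (I * (t * (μ - Real.log n) : ℝ)))
    (f := fun t => LSeries a (σ + t * I) * exp (I * (t * μ : ℝ)))
    (fun n _ => ‖LSeries.term a σ n‖) (fun n => (by fun_prop : Continuous _).aestronglyMeasurable)
    (fun n => Eventually.of_forall fun t _ => (hnorm t n).le)
    (Eventually.of_forall fun t _ => Summable.norm ha)
    intervalIntegrable_const
    (Eventually.of_forall fun t _ => by
      simp only [← hterm]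
      refine HasSum.mul_right _ (Summable.hasSum ?_)
      exact ha.of_re_le_re (by simp))
  exact hs.tsum_eq

/-- By Cauchy's theorem for rectangles, the mean value of a bounded holomorphic function on a
vertical line does not depend on the line. -/
lemma HasMean.shift_of_differentiableOn {h : ℂ → ℂ} {x σ σ' C : ℝ} {c : ℂ}
    (hh : DifferentiableOn ℂ h {s | x < s.re}) (hσ : x < σ) (hσσ' : σ ≤ σ')
    (hC : ∀ s : ℂ, σ ≤ s.re → s.re ≤ σ' → ‖h s‖ ≤ C)
    (hmean : HasMean (fun t => h (σ' + t * I)) c) : HasMean (fun t => h (σ + t * I)) c := by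
  have hdiff : Tendsto (fun T : ℝ => ((2 * T : ℝ) : ℂ)⁻¹ *
      ((∫ t in (-T)..T, h (σ' + t * I)) - ∫ t in (-T)..T, h (σ + t * I))) atTop (nhds 0) := by
    have hinv : Tendsto (fun T : ℝ => (T : ℝ)⁻¹ * (C * (σ' - σ))) atTop (nhds 0) := by
      simpa using tendsto_inv_atTop_zero.mul_const (C * (σ' - σ))
    refine squeeze_zero_norm' ?_ hinv
    filter_upwards [eventually_gt_atTop 0] with T hT
    have hrect := integral_boundary_rect_eq_zero_of_differentiableOn h
      (σ + (-T : ℝ) * I) (σ' + T * I) (hh.mono fun s hs => by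
        have := hs.1
        simp only [Set.mem_preimage, add_re, ofReal_re, mul_re, I_re, mul_zero, ofReal_im, I_im,
          mul_one, sub_self, add_zero, Set.uIcc_of_le hσσ', Set.mem_Icc] at this
        exact hσ.trans_le this.1)
    simp only [add_re, ofReal_re, mul_re, I_re, mul_zero, ofReal_im, I_im, mul_one, sub_self,
      add_zero, add_im, mul_im, zero_add, smul_eq_mul] at hrect
    have hhor : ∀ u : ℝ, ‖∫ y in σ..σ', h (y + u * I)‖ ≤ C * (σ' - σ) := fun u => by
      have := intervalIntegral.norm_integral_le_of_norm_le_const (a := σ) (b := σ')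
        (f := fun y : ℝ => h (y + u * I)) (C := C) fun y hy => by
          rw [Set.uIoc_of_le hσσ'] at hy
          exact hC _ (by simpa using hy.1.le) (by simpa using hy.2)
      rwa [abs_of_nonneg (by linarith)] at this
    have heq : (∫ t in (-T)..T, h (σ' + t * I)) - ∫ t in (-T)..T, h (σ + t * I) =
        I * ((∫ y in σ..σ', h (y + (-T : ℝ) * I)) - ∫ y in σ..σ', h (y + T * I)) := by
      linear_combination (-I) * hrect + ((∫ t in (-T)..T, h (σ' + t * I)) -
        ∫ t in (-T)..T, h (σ + t * I)) * I_mul_I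
    have h4 := norm_sub_le (∫ y in σ..σ', h (y + (-T : ℝ) * I)) (∫ y in σ..σ', h (y + T * I))
    rw [heq, norm_mul, norm_inv, norm_real, Real.norm_of_nonneg (by positivity), norm_mul, norm_I,
      one_mul, mul_inv, mul_comm (2⁻¹ : ℝ), mul_assoc]
    refine mul_le_mul_of_nonneg_left ?_ (by positivity)
    have := hhor T
    have := hhor (-T)
    linarith
  have := Tendsto.sub hmean hdiff
  rw [sub_zero] at this
  refine this.congr fun T => ?_
  ring

/-- Bohr's mean value for a bounded holomorphic continuation of a Dirichlet series, on lines
possibly to the left of the half-plane of convergence. -/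
lemma hasMean_mul_exp_of_bounded {a : ℕ → ℂ} {f : ℂ → ℂ} {x y C σ : ℝ}
    (hf : DifferentiableOn ℂ f {s | x < s.re}) (hC : ∀ s : ℂ, x < s.re → ‖f s‖ ≤ C)
    (hy : ∀ s : ℂ, y < s.re → LSeriesSummable a s ∧ f s = LSeries a s) (hσ : x < σ)
    {m d : ℕ} (hm : m ≠ 0) (hd : d ≠ 0) (hmd : m.Coprime d) :
    HasMean (fun t => f (σ + t * I) * exp (I * (t * (Real.log m - Real.log d) : ℝ)))
      (if d = 1 then LSeries.term a σ m else 0) := by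
  set μ : ℝ := Real.log m - Real.log d with hμ
  obtain ⟨σ', hσ'⟩ : ∃ σ', max σ y < σ' := exists_gt _
  obtain ⟨hσσ', hyσ'⟩ := max_lt_iff.mp hσ'
  have hC0 : 0 ≤ C := (norm_nonneg _).trans (hC σ (by simpa using hσ))
  -- the value of the mean on the line `Re s = σ'`
  have hval : (∑' n : ℕ, if Real.log n = μ then LSeries.term a σ' n else 0) =
      if d = 1 then LSeries.term a σ' m else 0 := by
    have hlog : ∀ n : ℕ, n ≠ 0 → (Real.log n = μ ↔ n * d = m) := fun n hn => by
      have hn' : (n : ℝ) ≠ 0 := by exact_mod_cast hn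
      have hd' : (d : ℝ) ≠ 0 := by exact_mod_cast hd
      rw [hμ, eq_sub_iff_add_eq, ← Real.log_mul hn' hd', ← Nat.cast_mul]
      constructor
      · intro h
        exact_mod_cast Real.log_injOn_pos (Set.mem_Ioi.mpr (by positivity))
          (Set.mem_Ioi.mpr (by positivity)) h
      · rintro rfl; rfl
    split_ifs with h1
    · rw [tsum_eq_single m, if_pos ((hlog m hm).mpr (by simp [h1]))]
      intro n hnm
      rcases eq_or_ne n 0 with rfl | hn
      · simp
      rw [if_neg]
      rw [hlog n hn]
      simpa [h1] using hnm
    · convert tsum_zero with n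
      rcases eq_or_ne n 0 with rfl | hn
      · simp
      rw [if_neg]
      rw [hlog n hn]
      rintro rfl
      exact h1 (Nat.eq_one_of_dvd_coprimes hmd (dvd_mul_left _ _) dvd_rfl)
  have h1 := hasMean_LSeries_mul_exp (hy σ' (by simpa using hyσ')).1 μ
  rw [hval] at h1
  -- `f(s) e^{μ s}` is the function whose mean is independent of the line
  have hsplit : ∀ (τ t : ℝ), f (τ + t * I) * exp (μ * (τ + t * I)) =
      exp (μ * τ) * (f (τ + t * I) * exp (I * (t * μ : ℝ))) := fun τ t => by
    rw [mul_left_comm, ← exp_add]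
    congr 2
    push_cast
    ring
  have h2 : HasMean (fun t => f (σ' + t * I) * exp (μ * (σ' + t * I)))
      (exp (μ * σ') * if d = 1 then LSeries.term a σ' m else 0) := by
    simp only [hsplit]
    refine HasMean.const_mul ?_ _
    convert h1 using 3 with t
    exact (hy _ (by simpa using hyσ')).2
  have h3 := h2.shift_of_differentiableOn (h := fun s => f s * exp (μ * s))
    (C := C * Real.exp (|μ| * max |σ| |σ'|))
    (hf.mul (by fun_prop)) hσ hσσ'.le fun s hs1 hs2 => by
      rw [norm_mul, norm_exp, re_ofReal_mul]
      have hexp : μ * s.re ≤ |μ| * max |σ| |σ'| :=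
        ((le_abs_self _).trans (abs_mul _ _).le).trans
          (mul_le_mul_of_nonneg_left (abs_le_max_abs_abs hs1 hs2) (abs_nonneg _))
      exact mul_le_mul (hC s (hσ.trans_le hs1)) (Real.exp_le_exp.mpr hexp) (Real.exp_nonneg _) hC0
  simp only [hsplit] at h3
  have h4 := h3.const_mul (exp (-(μ * σ)))
  convert h4 using 1
  · funext t
    rw [← mul_assoc, ← exp_add]
    simp
  · split_ifs with hd1
    · have hm' : (m : ℂ) ≠ 0 := by exact_mod_cast hm
      have hpow : exp (-(μ * σ)) * (exp (μ * σ') * (m : ℂ) ^ (-(σ' : ℂ))) =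
          (m : ℂ) ^ (-(σ : ℂ)) := by
        rw [cpow_def_of_ne_zero hm', cpow_def_of_ne_zero hm', ← exp_add, ← exp_add, ← natCast_log,
          hμ, hd1]
        congr 1
        simp only [Nat.cast_one, Real.log_one, sub_zero]
        ring
      rw [LSeries.term_of_ne_zero hm, LSeries.term_of_ne_zero hm, div_eq_mul_inv, ← cpow_neg,
        div_eq_mul_inv, ← cpow_neg, ← hpow]
      ring
    · simp

/-! ### Riesz products -/

/-- The Riesz product `∏_{p ∈ P} (1 + cos (θ_p + k t log p))`. -/
noncomputable def rieszProduct (P : Finset ℕ) (k : ℕ) (θ : ℕ → ℝ) (t : ℝ) : ℝ :=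
  ∏ p ∈ P, (1 + Real.cos (θ p + t * (k * Real.log p)))

lemma rieszProduct_nonneg (P : Finset ℕ) (k : ℕ) (θ : ℕ → ℝ) (t : ℝ) :
    0 ≤ rieszProduct P k θ t :=
  Finset.prod_nonneg fun p _ => by linarith [Real.neg_one_le_cos (θ p + t * (k * Real.log p))]

lemma continuous_rieszProduct (P : Finset ℕ) (k : ℕ) (θ : ℕ → ℝ) :
    Continuous (rieszProduct P k θ) := by
  unfold rieszProduct
  fun_prop

/-- Suppose that the Fourier coefficients of `g` at the frequencies `log (m / d)`, with `m`, `d`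
coprime, are `A m` for `d = 1` and `0` otherwise, and that `A` is multiplicative. Then integration
against a Riesz product multiplies the local factors. The frequency `log (m / d)` is kept general
to make the induction on `P` possible: expanding the factor at `p` leads to the frequencies of
`m / d`, `m p ^ k / d` and `m / (d p ^ k)`, the last of which contributes nothing. -/
lemma hasMean_mul_rieszProduct {g : ℝ → ℂ} {A : ℕ → ℂ} (hgc : Continuous g)
    (hg : ∀ m d : ℕ, m ≠ 0 → d ≠ 0 → m.Coprime d →
      HasMean (fun t => g t * exp (I * (t * (Real.log m - Real.log d) : ℝ)))
        (if d = 1 then A m else 0))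
    (hA : ∀ m n : ℕ, m ≠ 0 → n ≠ 0 → m.Coprime n → A (m * n) = A m * A n)
    {k : ℕ} (hk : k ≠ 0) (θ : ℕ → ℝ) (P : Finset ℕ) (hP : ∀ p ∈ P, p.Prime)
    {m d : ℕ} (hm : m ≠ 0) (hd : d ≠ 0) (hmd : m.Coprime d)
    (hmP : ∀ p ∈ P, p.Coprime m) (hdP : ∀ p ∈ P, p.Coprime d) :
    HasMean (fun t => g t * exp (I * (t * (Real.log m - Real.log d) : ℝ)) * rieszProduct P k θ t)
      (if d = 1 then A m * ∏ p ∈ P, (1 + exp (I * θ p) * A (p ^ k) / 2) else 0) := by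
  induction P using Finset.induction_on generalizing m d with
  | empty => simpa [rieszProduct] using hg m d hm hd hmd
  | insert p P hpP ih =>
    have hp : p.Prime := hP p (Finset.mem_insert_self _ _)
    have hpk : p ^ k ≠ 0 := pow_ne_zero _ hp.ne_zero
    have hPP : ∀ q ∈ P, q.Prime := fun q hq => hP q (Finset.mem_insert_of_mem hq)
    have hqp : ∀ q ∈ P, q.Coprime (p ^ k) := fun q hq =>
      Nat.Coprime.pow_right _ ((Nat.coprime_primes (hPP q hq) hp).mpr (by rintro rfl; exact hpP hq))
    have hpm : (p ^ k).Coprime m := (hmP p (Finset.mem_insert_self _ _)).pow_left k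
    have hpd : (p ^ k).Coprime d := (hdP p (Finset.mem_insert_self _ _)).pow_left k
    have hmP' : ∀ q ∈ P, q.Coprime m := fun q hq => hmP q (Finset.mem_insert_of_mem hq)
    have hdP' : ∀ q ∈ P, q.Coprime d := fun q hq => hdP q (Finset.mem_insert_of_mem hq)
    have h0 := ih hPP hm hd hmd hmP' hdP'
    have h1 := ih hPP (m := m * p ^ k) (mul_ne_zero hm hpk) hd (hmd.mul_left hpd)
      (fun q hq => (hmP' q hq).mul_right (hqp q hq)) hdP'
    have h2 := ih hPP (d := d * p ^ k) hm (mul_ne_zero hd hpk) (hmd.mul_right hpm.symm) hmP'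
      (fun q hq => (hdP' q hq).mul_right (hqp q hq))
    have hR := continuous_rieszProduct P k θ
    have hdpk : d * p ^ k ≠ 1 := fun h => by
      have h3 := (mul_eq_one.mp h).2
      exact hp.ne_one ((Nat.pow_eq_one.mp h3).resolve_right hk)
    rw [if_neg hdpk] at h2
    have key := (h0.add (h1.const_mul (exp (I * θ p) / 2)) (by fun_prop) (by fun_prop)).add
      (h2.const_mul (exp (-(I * θ p)) / 2)) (by fun_prop) (by fun_prop)
    convert key using 1
    · funext t
      have hlogp : ∀ j : ℕ, j ≠ 0 → Real.log (j * p ^ k : ℕ) = Real.log j + k * Real.log p :=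
        fun j hj => by
          rw [Nat.cast_mul, Real.log_mul (by exact_mod_cast hj) (by exact_mod_cast hpk),
            Nat.cast_pow, Real.log_pow]
      have e1 : exp (I * (t * (Real.log (m * p ^ k : ℕ) - Real.log d) : ℝ)) =
          exp (I * (t * (Real.log m - Real.log d) : ℝ)) * exp (I * (t * (k * Real.log p) : ℝ)) := by
        rw [hlogp m hm, ← exp_add]; congr 1; push_cast; ring
      have e2 : exp (I * (t * (Real.log m - Real.log (d * p ^ k : ℕ)) : ℝ)) =
          exp (I * (t * (Real.log m - Real.log d) : ℝ)) *
            exp (-(I * (t * (k * Real.log p) : ℝ))) := by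
        rw [hlogp d hd, ← exp_add]; congr 1; push_cast; ring
      have e3 : ((1 + Real.cos (θ p + t * (k * Real.log p)) : ℝ) : ℂ) =
          1 + (exp (I * θ p) * exp (I * (t * (k * Real.log p) : ℝ)) +
            exp (-(I * θ p)) * exp (-(I * (t * (k * Real.log p) : ℝ)))) / 2 := by
        rw [← exp_add, ← exp_add, ofReal_add, ofReal_cos, Complex.cos, ofReal_one]
        congr 4 <;> push_cast <;> ring
      have e4 : rieszProduct (insert p P) k θ t =
          (1 + Real.cos (θ p + t * (k * Real.log p))) * rieszProduct P k θ t :=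
        Finset.prod_insert hpP
      rw [e1, e2, e4, ofReal_mul (1 + Real.cos _), e3]
      ring
    · rw [Finset.prod_insert hpP, hA m (p ^ k) hm hpk hpm.symm]
      split_ifs <;> ring

/-- The mean of a Riesz product is `1`, hence a bound for `f` on the half-plane is also a bound for
the mean of `f` against it; choosing `θ_p` to cancel the argument of the coefficient at `p ^ k`
makes that mean a product of positive terms. -/
lemma prod_one_add_norm_term_le {a : ℕ → ℂ} {f : ℂ → ℂ} {x y C σ : ℝ} (ha1 : a 1 = 1)
    (hmul : ∀ {m n : ℕ}, m ≠ 0 → n ≠ 0 → m.Coprime n → a (m * n) = a m * a n)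
    (hf : DifferentiableOn ℂ f {s | x < s.re}) (hC : ∀ s : ℂ, x < s.re → ‖f s‖ ≤ C)
    (hy : ∀ s : ℂ, y < s.re → LSeriesSummable a s ∧ f s = LSeries a s) (hσ : x < σ)
    {k : ℕ} (hk : k ≠ 0) (P : Finset ℕ) (hP : ∀ p ∈ P, p.Prime) :
    ∏ p ∈ P, (1 + ‖LSeries.term a σ (p ^ k)‖ / 2) ≤ C := by
  set A : ℕ → ℂ := LSeries.term a σ with hAdef
  set θ : ℕ → ℝ := fun p => -(A (p ^ k)).arg with hθ
  have hA : ∀ m n : ℕ, m ≠ 0 → n ≠ 0 → m.Coprime n → A (m * n) = A m * A n := by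
    intro m n hm hn hmn
    simp only [hAdef]
    rw [LSeries.term_of_ne_zero hm, LSeries.term_of_ne_zero hn,
      LSeries.term_of_ne_zero (mul_ne_zero hm hn), hmul hm hn hmn, Nat.cast_mul,
      natCast_mul_natCast_cpow, mul_div_mul_comm]
  have hgc : Continuous fun t : ℝ => f (σ + t * I) :=
    hf.continuousOn.comp_continuous (by fun_prop) fun t => by simpa using hσ
  have hmean := hasMean_mul_rieszProduct (A := A) hgc
    (fun m d hm hd hmd => hasMean_mul_exp_of_bounded hf hC hy hσ hm hd hmd) hA hk θ P hP
    one_ne_zero one_ne_zero (Nat.coprime_one_left 1) (fun _ _ => Nat.coprime_one_right _)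
    (fun _ _ => Nat.coprime_one_right _)
  -- the Riesz product alone, as the case of the Dirichlet series `1`
  have hmean1 := hasMean_mul_rieszProduct (g := fun _ => 1) (A := fun n => if n = 1 then 1 else 0)
    continuous_const (fun m d hm hd hmd => by
      convert hasMean_exp (Real.log m - Real.log d) using 1
      · simp
      · have : Real.log m - Real.log d = 0 ↔ m = d := by
          rw [sub_eq_zero]
          refine ⟨fun h => ?_, fun h => by rw [h]⟩
          exact_mod_cast Real.log_injOn_pos (Set.mem_Ioi.mpr (by positivity))
            (Set.mem_Ioi.mpr (by positivity)) h
        simp only [this]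
        rcases eq_or_ne d 1 with rfl | hd1
        · simp
        · rw [if_neg hd1, if_neg]
          rintro rfl
          exact hd1 (by simpa using hmd))
    (fun m n _ _ _ => by by_cases h : m = 1 <;> simp [h]) hk θ P hP
    one_ne_zero one_ne_zero (Nat.coprime_one_left 1) (fun _ _ => Nat.coprime_one_right _)
    (fun _ _ => Nat.coprime_one_right _)
  have hpk : ∀ p ∈ P, p ^ k ≠ 1 := fun p hp h =>
    (hP p hp).ne_one ((Nat.pow_eq_one.mp h).resolve_right hk)
  have hone : ∏ p ∈ P, (1 + exp (I * θ p) * (if p ^ k = 1 then (1 : ℂ) else 0) / 2) = 1 :=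
    Finset.prod_eq_one fun p hp => by rw [if_neg (hpk p hp)]; simp
  have hA1 : A 1 = 1 := by simp [hAdef, ha1]
  have hprod : ∏ p ∈ P, (1 + exp (I * θ p) * A (p ^ k) / 2) =
      ((∏ p ∈ P, (1 + ‖A (p ^ k)‖ / 2) : ℝ) : ℂ) := by
    push_cast
    refine Finset.prod_congr rfl fun p _ => ?_
    congr 2
    conv_lhs => rw [← norm_mul_exp_arg_mul_I (A (p ^ k)), mul_left_comm, ← exp_add]
    simp [hθ, mul_comm I]
  simp only [if_true, hone, hprod, hA1, one_mul, Nat.cast_one, Real.log_one, sub_self, mul_zero,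
    ofReal_zero, exp_zero, mul_one] at hmean hmean1
  have := hmean.norm_le hmean1 (continuous_rieszProduct P k θ) (C := C) fun t => by
    rw [norm_mul, norm_real, Real.norm_of_nonneg (rieszProduct_nonneg P k θ t)]
    exact mul_le_mul_of_nonneg_right (hC _ (by simpa using hσ)) (rieszProduct_nonneg P k θ t)
  rw [norm_real, one_re, mul_one] at this
  exact (le_abs_self _).trans this

lemma one_add_sum_le_prod_one_add {ι : Type*} (s : Finset ι) {f : ι → ℝ} (hf : ∀ i, 0 ≤ f i) :
    1 + ∑ i ∈ s, f i ≤ ∏ i ∈ s, (1 + f i) := by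
  classical
  induction s using Finset.induction_on with
  | empty => simp
  | insert i s hi ih =>
    rw [Finset.sum_insert hi, Finset.prod_insert hi]
    nlinarith [hf i, Finset.sum_nonneg fun j (_ : j ∈ s) => hf j]

lemma sum_norm_term_prime_pow_le {a : ℕ → ℂ} {f : ℂ → ℂ} {x y C σ : ℝ} (ha1 : a 1 = 1)
    (hmul : ∀ {m n : ℕ}, m ≠ 0 → n ≠ 0 → m.Coprime n → a (m * n) = a m * a n)
    (hf : DifferentiableOn ℂ f {s | x < s.re}) (hC : ∀ s : ℂ, x < s.re → ‖f s‖ ≤ C)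
    (hy : ∀ s : ℂ, y < s.re → LSeriesSummable a s ∧ f s = LSeries a s) (hσ : x < σ)
    {k : ℕ} (hk : k ≠ 0) (P : Finset ℕ) (hP : ∀ p ∈ P, p.Prime) :
    ∑ p ∈ P, ‖LSeries.term a σ (p ^ k)‖ ≤ 2 * C := by
  have h1 := prod_one_add_norm_term_le ha1 hmul hf hC hy hσ hk P hP
  have h2 := one_add_sum_le_prod_one_add P (f := fun p => ‖LSeries.term a σ (p ^ k)‖ / 2)
    fun p => by positivity
  rw [← Finset.sum_div] at h2
  linarith

/-! ### Absolute convergence -/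

/-- Boundedness on `Re s > x` forces absolute convergence on `Re s > x`, for multiplicative
coefficients. The bounds for the sums over `p ^ k` with `k` fixed are uniform in `k`; moving
slightly to the right gains the factor `p ^ (-k δ) ≤ 2 ^ (-k δ)`, which makes them summable
over `k`. -/
lemma LSeriesSummable_of_bounded {a : ℕ → ℂ} {f : ℂ → ℂ} {x y C x' : ℝ} (ha1 : a 1 = 1)
    (hmul : ∀ {m n : ℕ}, m ≠ 0 → n ≠ 0 → m.Coprime n → a (m * n) = a m * a n)
    (hf : DifferentiableOn ℂ f {s | x < s.re}) (hC : ∀ s : ℂ, x < s.re → ‖f s‖ ≤ C)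
    (hy : ∀ s : ℂ, y < s.re → LSeriesSummable a s ∧ f s = LSeries a s) (hx' : x < x') :
    LSeriesSummable a x' := by
  obtain ⟨σ, hxσ, hσx'⟩ := exists_between hx'
  set q : ℝ := (2 : ℝ) ^ (-(x' - σ)) with hq
  have hq0 : 0 < q := by positivity
  have hq1 : q < 1 := Real.rpow_lt_one_of_one_lt_of_neg one_lt_two (by linarith)
  have hC0 : 0 ≤ C := (norm_nonneg _).trans (hC x' (by simpa using hx'))
  set v : ℕ → ℝ := fun n => ‖LSeries.term a x' n‖ with hv
  have hvterm : ∀ {p k : ℕ}, p.Prime → v (p ^ k) ≤ ‖LSeries.term a σ (p ^ k)‖ * q ^ k := by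
    intro p k hp
    have hpk : p ^ k ≠ 0 := pow_ne_zero _ hp.ne_zero
    have hppos : (0 : ℝ) < (p : ℝ) := by exact_mod_cast hp.pos
    have hpow : ∀ u : ℝ, ((p ^ k : ℕ) : ℝ) ^ u = ((p : ℝ) ^ u) ^ k := fun u => by
      rw [Nat.cast_pow, ← Real.rpow_natCast_mul hppos.le, mul_comm,
        Real.rpow_mul_natCast hppos.le]
    simp only [hv]
    rw [LSeries.norm_term_eq, LSeries.norm_term_eq, if_neg hpk, if_neg hpk, ofReal_re, ofReal_re,
      hpow, hpow, div_mul_eq_mul_div, div_eq_mul_inv, div_eq_mul_inv, mul_assoc, ← inv_pow,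
      ← inv_pow, ← mul_pow, ← Real.rpow_neg hppos.le, ← Real.rpow_neg hppos.le]
    have h2p : (p : ℝ) ^ (-(x' - σ)) ≤ q :=
      Real.rpow_le_rpow_of_nonpos two_pos (by exact_mod_cast hp.two_le) (by linarith)
    have : (p : ℝ) ^ (-x') = (p : ℝ) ^ (-(x' - σ)) * (p : ℝ) ^ (-σ) := by
      rw [← Real.rpow_add hppos]; congr 1; ring
    rw [this]
    gcongr
  have hsumk : ∀ (P : Finset ℕ), (∀ p ∈ P, p.Prime) → ∀ k : ℕ,
      ∑ p ∈ P, v (p ^ (k + 1)) ≤ 2 * C * q ^ (k + 1) := by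
    intro P hP k
    calc ∑ p ∈ P, v (p ^ (k + 1)) ≤ ∑ p ∈ P, ‖LSeries.term a σ (p ^ (k + 1))‖ * q ^ (k + 1) :=
          Finset.sum_le_sum fun p hp => hvterm (hP p hp)
      _ ≤ _ := by
          rw [← Finset.sum_mul]
          gcongr
          exact sum_norm_term_prime_pow_le ha1 hmul hf hC hy hxσ k.succ_ne_zero P hP
  have hgeom : Summable fun k : ℕ => 2 * C * q ^ (k + 1) :=
    ((summable_nat_add_iff 1).mpr (summable_geometric_of_lt_one hq0.le hq1)).mul_left _
  have hsumm : ∀ {p : ℕ}, p.Prime → Summable fun k : ℕ => v (p ^ (k + 1)) := fun {p} hp =>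
    Summable.of_nonneg_of_le (fun k => norm_nonneg _)
      (fun k => by simpa using hsumk {p} (by simpa using hp) k) hgeom
  have hsum0 : ∀ {p : ℕ}, p.Prime → Summable fun k : ℕ => v (p ^ k) := fun hp =>
    (summable_nat_add_iff 1).mp (hsumm hp)
  have hv1 : v 1 = 1 := by simp [hv, ha1]
  have hvmul : ∀ {m n : ℕ}, m.Coprime n → v (m * n) = v m * v n := by
    intro m n hmn
    simp only [hv]
    rcases eq_or_ne m 0 with rfl | hm
    · simp
    rcases eq_or_ne n 0 with rfl | hn
    · simp
    rw [LSeries.term_of_ne_zero hm, LSeries.term_of_ne_zero hn,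
      LSeries.term_of_ne_zero (mul_ne_zero hm hn), hmul hm hn hmn, Nat.cast_mul,
      natCast_mul_natCast_cpow, mul_div_mul_comm, norm_mul]
  refine Summable.of_norm (summable_of_sum_range_le
    (c := Real.exp (∑' k : ℕ, 2 * C * q ^ (k + 1))) (fun n => norm_nonneg _) fun N => ?_)
  have hEuler := EulerProduct.summable_and_hasSum_smoothNumbers_prod_primesBelow_tsum hv1 hvmul
    (fun hp => by simpa only [hv, norm_norm] using hsum0 hp) N
  have hprime : ∀ p ∈ N.primesBelow, p.Prime := fun p hp => Nat.prime_of_mem_primesBelow hp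
  calc ∑ n ∈ Finset.range N, v n = ∑ n ∈ (Finset.range N).erase 0, v n := by
        rw [Finset.sum_erase _ (by simp [hv])]
    _ ≤ ∑' m : N.smoothNumbers, v m := by
        have hmem : ∀ n ∈ (Finset.range N).erase 0, n ∈ N.smoothNumbers := fun n hn =>
          Nat.mem_smoothNumbers_of_lt (Nat.pos_of_ne_zero (Finset.mem_erase.mp hn).1)
            (Finset.mem_range.mp (Finset.mem_erase.mp hn).2)
        rw [← Finset.sum_subtype_of_mem v hmem]
        exact hEuler.2.summable.sum_le_tsum _ fun _ _ => norm_nonneg _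
    _ = ∏ p ∈ N.primesBelow, ∑' k : ℕ, v (p ^ k) := hEuler.2.tsum_eq
    _ ≤ ∏ p ∈ N.primesBelow, Real.exp (∑' k : ℕ, v (p ^ (k + 1))) := by
        refine Finset.prod_le_prod (fun p _ => tsum_nonneg fun k => norm_nonneg _) fun p hp => ?_
        rw [(hsum0 (hprime p hp)).tsum_eq_zero_add, pow_zero, hv1, add_comm]
        exact Real.add_one_le_exp _
    _ = Real.exp (∑' k : ℕ, ∑ p ∈ N.primesBelow, v (p ^ (k + 1))) := by
        rw [← Real.exp_sum, Summable.tsum_finsetSum fun p hp => hsumm (hprime p hp)]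
    _ ≤ _ := by
        refine Real.exp_le_exp.mpr (Summable.tsum_le_tsum (hsumk _ hprime) ?_ hgeom)
        exact summable_sum fun p hp => hsumm (hprime p hp)

/-- Absolute convergence in every half-plane of boundedness, for multiplicative coefficients. -/
lemma abscissaOfAbsConv_le_abscissaOfBoundedness {a : ℕ → ℂ} (ha1 : a 1 = 1)
    (hmul : ∀ {m n : ℕ}, m ≠ 0 → n ≠ 0 → m.Coprime n → a (m * n) = a m * a n) :
    LSeries.abscissaOfAbsConv a ≤ abscissaOfBoundedness a := by
  refine le_sInf ?_
  rintro _ ⟨x, ⟨f, hf, ⟨C, hC⟩, y, -, hy⟩, rfl⟩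
  exact LSeries.abscissaOfAbsConv_le_of_forall_lt_LSeriesSummable fun x' hx' =>
    LSeriesSummable_of_bounded ha1 hmul hf hC hy hx'

theorem theorem1 (a : ℕ → ℂ) (ha : IsSelbergClass a) :
    abscissaOfBoundedness a = abscissaOfUnifConv a ∧
      abscissaOfUnifConv a = LSeries.abscissaOfAbsConv a := by
  have hbu := abscissaOfBoundedness_le_abscissaOfUnifConv ha.summable
  have hua := abscissaOfUnifConv_le_abscissaOfAbsConv a
  have hab := abscissaOfAbsConv_le_abscissaOfBoundedness ha.map_mul_of_coprime.1
    ha.map_mul_of_coprime.2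
  exact ⟨hbu.antisymm (hua.trans hab), hua.antisymm (hab.trans hbu)⟩
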